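/- All graphs are finite and simple. A hypergraph $\mathcal H$ is a Berge copy of a graph $F$ if the vertices of $F$ can be identified with distinct vertices of $\mathcal H$ so that there is a bijection $f:E(F)\to E(\mathcal H)$ with $a\subseteq f(a)$ for every edge $a\in E(F)$. For integers $r,n$ let $\mathrm{ex}_r(n,\text{Berge-}F)$ be the maximum number of hyperedges of an $r$-uniform hypergraph on $n$ vertices (without repeated hyperedges) none of whose subhypergraphs is a Berge copy of $F$. The uniformity threshold $\mathrm{th}(F)$ is the smallest integer $r_0\ge 2$ such that $\mathrm{ex}_r(n,\text{Berge-}F)=o(n^2)$ as $n\to\infty$ for every fixed $r\ge r_0$. For graphs $H,G$, the Ramsey number $R(H,G)$ is the smallest $N$ such that every colouring of the edges of $K_N$ with blue and red contains a blue copy of $H$ or a red copy of $G$ (not necessarily induced). Theorem. Let $F$ be a graph, let $e$ be an edge of $F$, and let $F\setminus e$ be the graph obtained from $F$ by deleting the edge $e$ and keeping all vertices. Then $\mathrm{th}(F)$ and $R(K_{\chi(F)},F\setminus e)$ exist, and $$\mathrm{th}(F)\le R\bigl(K_{\chi(F)},F\setminus e\bigr),$$ where $\chi(F)$ is the chromatic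 number of $F$. -/

import Mathlib

open Filter Asymptotics
open scoped SimpleGraph

namespace BergeThreshold

/-- The hypergraph with hyperedges `E` (finite subsets of the vertex set `α`) is a Berge copy of
`F`: the vertices of `F` are placed injectively on vertices of the hypergraph, and some bijection
from the edges of `F` onto the hyperedges sends every edge to a hyperedge containing it. -/
def IsBergeCopy {V α : Type*} (F : SimpleGraph V) (E : Set (Finset α)) : Prop :=
  ∃ φ : V ↪ α, ∃ f : F.edgeSet ≃ E, ∀ e : F.edgeSet, ∀ v ∈ (e : Sym2 V), φ v ∈ (f e : Finset α)

/-- No subhypergraph is a Berge copy of `F`. -/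
def IsBergeFree {V α : Type*} (F : SimpleGraph V) (E : Set (Finset α)) : Prop :=
  ∀ E' ⊆ E, ¬ IsBergeCopy F E'

open Classical in
/-- `ex_r(n, Berge-F)`: the maximum number of hyperedges of an `r`-uniform Berge-`F`-free hypergraph
on `n` vertices. -/
noncomputable def bergeEx {V : Type*} (F : SimpleGraph V) (r n : ℕ) : ℕ :=
  (Finset.univ.filter fun E : Finset (Finset (Fin n)) =>
    (E : Set (Finset (Fin n))).Sized r ∧ IsBergeFree F (E : Set (Finset (Fin n)))).sup Finset.card

/-- The uniformities `r₀` such that `ex_r(n, Berge-F) = o(n²)` for every `r ≥ r₀`. As usual,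
uniformities are at least 2. -/
def thresholdSet {V : Type*} (F : SimpleGraph V) : Set ℕ :=
  {r₀ | 2 ≤ r₀ ∧ ∀ r ≥ r₀,
    (fun n : ℕ => (bergeEx F r n : ℝ)) =o[atTop] (fun n : ℕ => (n : ℝ) ^ 2)}

/-- The uniformity threshold `th(F)`. -/
noncomputable def th {V : Type*} (F : SimpleGraph V) : ℕ := sInf (thresholdSet F)

/-- The numbers `N` such that every blue-red colouring of the edges of `K_N` has a blue copy of `H`
or a red copy of `G`. A colouring is given by its blue graph `B`; the red graph is then `Bᶜ`. -/
def ramseySet {U V : Type*} (H : SimpleGraph U) (G : SimpleGraph V) : Set ℕ :=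
  {N | ∀ B : SimpleGraph (Fin N), H ⊑ B ∨ G ⊑ Bᶜ}

/-- The off-diagonal Ramsey number `R(H, G)`. -/
noncomputable def ramsey {U V : Type*} (H : SimpleGraph U) (G : SimpleGraph V) : ℕ :=
  sInf (ramseySet H G)

/-- The complete graph `K_{χ(F)}`; the chromatic number of a graph on finitely many vertices is
finite, so `toNat` loses nothing there. -/
noncomputable abbrev chromaticClique {V : Type*} (F : SimpleGraph V) :
    SimpleGraph (Fin F.chromaticNumber.toNat) :=
  SimpleGraph.completeGraph (Fin F.chromaticNumber.toNat)

end BergeThreshold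

/-! Let `k = χ(F)` and let `F` have `q` edges. Suppose that a Berge-`F`-free hypergraph of
uniformity at least `R(K_k, F \ e)` has at least `c n²` hyperedges. Inside a hyperedge `h`, colour a
pair blue if fewer than `q` hyperedges contain it, and red otherwise. A red `F \ e` in `h` would
give a Berge `F`: `h` represents `e`, and by Hall's theorem the other edges can be given further
distinct hyperedges. So `h` contains a blue `K_k`.

Blue pairs have bounded codegree, so a positive proportion of these `k`-sets pairwise share at most
one vertex (`exists_subset_isLinear_image`). As in the removal lemma, regularity applied to the
union of these edge-disjoint cliques yields `k` large, pairwise dense and uniform sets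
(`eventually_exists_isUniform_parts`), into which the `k`-colourable `F` embeds greedily. The
embedding is steered so that no `k`-set contains three image vertices. Distinct edges of `F` then
lie in distinct `k`-sets, hence in distinct hyperedges: a contradiction. -/

namespace BergeThreshold

open Finset

/-! ### Greedy embedding into uniform dense pairs -/

section Embedding

variable {V ι α : Type*} {G : SimpleGraph α} [DecidableRel G.Adj]

/-- In an `ε`-uniform pair of density at least `δ`, few vertices of the first set have fewer than
the expected number of neighbours in a given large subset of the second one. -/
theorem card_lowDegree_lt {ε δ : ℝ} {s t t' : Finset α} (hu : G.IsUniform ε s t)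
    (hd : δ ≤ G.edgeDensity s t) (hεδ : ε ≤ δ) (ht' : t' ⊆ t) (hlarge : (#t : ℝ) * ε ≤ #t') :
    (#{x ∈ s | (#{y ∈ t' | G.Adj x y} : ℝ) < (δ - ε) * #t'} : ℝ) < #s * ε := by
  by_contra! hcon
  set b := {x ∈ s | (#{y ∈ t' | G.Adj x y} : ℝ) < (δ - ε) * #t'} with hb
  have h1 := hu (filter_subset _ s) ht' hcon hlarge
  rw [← hb] at h1
  have h2 : (G.edgeDensity b t' : ℝ) ≤ δ - ε := by
    rw [SimpleGraph.edgeDensity_def]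
    push_cast
    refine div_le_of_le_mul₀ (by positivity) (by linarith) ?_
    have h3 : #(G.interedges b t') = ∑ x ∈ b, #{y ∈ t' | G.Adj x y} := by
      rw [SimpleGraph.interedges_def, card_filter, sum_product]
      simp only [card_filter]
    rw [h3]
    push_cast
    calc ∑ x ∈ b, (#{y ∈ t' | G.Adj x y} : ℝ) ≤ ∑ x ∈ b, (δ - ε) * #t' :=
          sum_le_sum fun x hx => (mem_filter.1 hx).2.le
      _ = (δ - ε) * (#b * #t') := by rw [sum_const, nsmul_eq_mul]; ring
  have h4 := (abs_lt.1 h1).1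
  linarith

/-- Greedy embedding of a coloured graph into pairwise uniform dense sets of vertices. The
embedding can be steered: the image satisfies any property `p` that is lost by at most `M` of the
possible next vertices in every step. -/
theorem exists_embedding_of_isUniform [DecidableEq α] [Fintype V] [DecidableEq V] {F : SimpleGraph V}
    (c : F.Coloring ι) (A : ι → Finset α) {ε δ : ℝ} (hε : 0 < ε) (hεδ : ε < δ) (hδ : δ ≤ 1)
    (hpow : (Fintype.card V + 1) * ε ≤ (δ - ε) ^ Fintype.card V)
    (hA : ∀ i j, i ≠ j → G.IsUniform ε (A i) (A j) ∧ δ ≤ G.edgeDensity (A i) (A j))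
    {M : ℕ} (hM : ∀ i, (M : ℝ) < #(A i) * ε)
    (p : Finset α → Prop) (hp₀ : p ∅)
    (hp : ∀ T, p T → #T < Fintype.card V →
      ∃ X : Finset α, #X ≤ M ∧ ∀ x ∉ X, x ∉ T ∧ p (insert x T)) :
    ∃ φ : V ↪ α, (∀ u v, F.Adj u v → G.Adj (φ u) (φ v)) ∧ p (univ.image φ) := by
  classical
  set m := Fintype.card V with hm
  set η := δ - ε with hη
  have hη0 : 0 < η := by linarith
  have hη1 : η ≤ 1 := by linarith
  have hApos : ∀ i, (0 : ℝ) < #(A i) := fun i => by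
    have h1 : (0 : ℝ) < #(A i) * ε := lt_of_le_of_lt (Nat.cast_nonneg M) (hM i)
    exact pos_of_mul_pos_left h1 hε.le
  -- Invariant: each vertex not yet placed keeps a proportion `η ^ #S` of its colour class as
  -- candidates.
  suffices H : ∀ S : Finset V, ∃ φ : V → α, Set.InjOn φ S ∧
      (∀ u ∈ S, ∀ v ∈ S, F.Adj u v → G.Adj (φ u) (φ v)) ∧ p (S.image φ) ∧
      ∀ w ∉ S, η ^ #S * #(A (c w)) ≤ #{x ∈ A (c w) | ∀ u ∈ S, F.Adj u w → G.Adj (φ u) x} by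
    obtain ⟨φ, h1, h2, h3, -⟩ := H univ
    exact ⟨⟨φ, fun a b h => h1 (by simp) (by simp) h⟩, fun u v => h2 u (by simp) v (by simp), h3⟩
  intro S
  induction S using Finset.induction_on with
  | empty =>
    obtain h | ⟨⟨v⟩⟩ := isEmpty_or_nonempty V
    · exact ⟨fun v => isEmptyElim v, by simp, by simp, by simpa using hp₀, by simp⟩
    · obtain ⟨x, -⟩ := card_pos.1 (by exact_mod_cast hApos (c v))
      exact ⟨fun _ => x, by simp, by simp, by simpa using hp₀, by simp⟩
  | insert v S hv ih =>
    obtain ⟨φ, hinj, hadj, hpS, hC⟩ := ih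
    set C : V → Finset α := fun w => {x ∈ A (c w) | ∀ u ∈ S, F.Adj u w → G.Adj (φ u) x} with hCdef
    have hSm : #S < m := card_lt_univ_of_notMem hv
    have hCsub : ∀ w, C w ⊆ A (c w) := fun w => filter_subset _ _
    have hηm : (m + 1) * ε ≤ η ^ #S :=
      hpow.trans (pow_le_pow_of_le_one hη0.le hη1 hSm.le)
    have hεη : ε ≤ η ^ #S := le_trans (by nlinarith [(Nat.cast_nonneg m : (0 : ℝ) ≤ m)]) hηm
    have hClarge : ∀ w ∉ S, (#(A (c w)) : ℝ) * ε ≤ #(C w) := fun w hw => by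
      refine le_trans ?_ (hC w hw)
      rw [mul_comm]
      gcongr
    let low : V → Finset α := fun w =>
      {x ∈ A (c v) | (#{y ∈ C w | G.Adj x y} : ℝ) < η * #(C w)}
    let W : Finset V := {w | w ∉ S ∧ F.Adj v w}
    have hlow : ∀ w ∈ W, (#(low w) : ℝ) ≤ #(A (c v)) * ε := by
      intro w hw
      obtain ⟨hw1, hw2⟩ : w ∉ S ∧ F.Adj v w := by simpa [W] using hw
      have h1 := hA _ _ (c.valid hw2)
      exact (card_lowDegree_lt h1.1 h1.2 hεδ.le (hCsub w) (hClarge w hw1)).le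
    obtain ⟨X, hXM, hX⟩ := hp _ hpS (lt_of_le_of_lt card_image_le hSm)
    have hWm : #W ≤ m := card_le_univ _
    have hbad : (#(W.biUnion low ∪ X) : ℝ) < #(C v) := by
      calc (#(W.biUnion low ∪ X) : ℝ) ≤ #(W.biUnion low) + #X := by exact_mod_cast card_union_le _ _
        _ ≤ ∑ w ∈ W, (#(low w) : ℝ) + M := by
            gcongr
            exact_mod_cast card_biUnion_le
        _ ≤ ∑ w ∈ W, (#(A (c v)) : ℝ) * ε + M := by gcongr with w hw; exact hlow w hw
        _ = #W * (#(A (c v)) * ε) + M := by rw [sum_const, nsmul_eq_mul]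
        -- `hpow` leaves room for `m + 1` losses of proportion `ε`: at most `m` from unplaced
        -- neighbours of `v`, and one from `X`.
        _ < m * (#(A (c v)) * ε) + #(A (c v)) * ε := by
            have h1 := hM (c v)
            have h2 : (#W : ℝ) ≤ m := by exact_mod_cast hWm
            have h3 : (#W : ℝ) * (#(A (c v)) * ε) ≤ m * (#(A (c v)) * ε) := by gcongr
            linarith
        _ = ((m + 1) * ε) * #(A (c v)) := by ring
        _ ≤ η ^ #S * #(A (c v)) := by gcongr
        _ ≤ #(C v) := hC v hv
    obtain ⟨x, hxC, hxbad⟩ := exists_mem_notMem_of_card_lt_card (by exact_mod_cast hbad)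
    simp only [mem_union, mem_biUnion, not_or, not_exists, not_and] at hxbad
    obtain ⟨hxT, hxp⟩ := hX x hxbad.2
    obtain ⟨hxA, hxadj⟩ := mem_filter.1 hxC
    have hφ' : ∀ u ∈ S, Function.update φ v x u = φ u := fun u hu =>
      Function.update_of_ne (ne_of_mem_of_not_mem hu hv) _ _
    have himg : S.image (Function.update φ v x) = S.image φ := image_congr hφ'
    refine ⟨Function.update φ v x, ?_, ?_, ?_, ?_⟩
    · rw [coe_insert, Set.injOn_insert (by simpa using hv)]
      refine ⟨hinj.congr fun u hu => (hφ' u hu).symm, ?_⟩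
      rw [← coe_image, himg]
      simpa using hxT
    · intro u hu w hw huw
      rw [mem_insert] at hu hw
      obtain rfl | hu := hu
      · obtain rfl | hw := hw
        · exact (F.irrefl huw).elim
        · rw [hφ' w hw, Function.update_self]
          exact (hxadj w hw huw.symm).symm
      · obtain rfl | hw := hw
        · rw [hφ' u hu, Function.update_self]
          exact hxadj u hu huw
        · rw [hφ' u hu, hφ' w hw]
          exact hadj u hu w hw huw
    · rw [image_insert, himg, Function.update_self]
      exact hxp
    · intro w hw
      rw [mem_insert, not_or] at hw
      rw [card_insert_of_notMem hv, pow_succ]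
      by_cases hvw : F.Adj v w
      · have h1 : η * #(C w) ≤ #{y ∈ C w | G.Adj x y} := by
          have := hxbad.1 w (by simpa [W] using ⟨hw.2, hvw⟩)
          simpa [low, hxA] using this
        calc η ^ #S * η * #(A (c w)) = η * (η ^ #S * #(A (c w))) := by ring
          _ ≤ η * #(C w) := by gcongr; exact hC w hw.2
          _ ≤ _ := h1
          _ ≤ _ := by
            norm_cast
            refine card_le_card fun y hy => ?_
            simp only [hCdef, mem_filter] at hy ⊢
            refine ⟨hy.1.1, fun u hu huw => ?_⟩
            obtain rfl | hu := mem_insert.1 hu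
            · rw [Function.update_self]; exact hy.2
            · rw [hφ' u hu]; exact hy.1.2 u hu huw
      · calc η ^ #S * η * #(A (c w)) ≤ η ^ #S * 1 * #(A (c w)) := by gcongr
          _ = η ^ #S * #(A (c w)) := by ring
          _ ≤ #(C w) := hC w hw.2
          _ ≤ _ := by
            norm_cast
            refine card_le_card fun y hy => ?_
            simp only [hCdef, mem_filter] at hy ⊢
            refine ⟨hy.1, fun u hu huw => ?_⟩
            obtain rfl | hu := mem_insert.1 hu
            · exact (hvw huw).elim
            · rw [hφ' u hu]; exact hy.2 u hu huw

end Embedding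

/-! ### Linear families and the regularity lemma -/

section LinearFamily

variable {α : Type*}

/-- Two distinct vertices are adjacent if some member of the family contains both. -/
def cliqueGraph (𝒬 : Finset (Finset α)) : SimpleGraph α where
  Adj x y := x ≠ y ∧ ∃ Q ∈ 𝒬, x ∈ Q ∧ y ∈ Q
  symm.symm := fun _ _ ⟨h, Q, hQ, hx, hy⟩ => ⟨h.symm, Q, hQ, hy, hx⟩
  loopless.irrefl := fun _ h => h.1 rfl

/-- Two members of the family that share two vertices are equal. -/
def IsLinear (𝒬 : Finset (Finset α)) : Prop :=
  ∀ Q ∈ 𝒬, ∀ R ∈ 𝒬, ∀ x y, x ≠ y → x ∈ Q → y ∈ Q → x ∈ R → y ∈ R → Q = R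

/-- If every member of a linear family contains a pair from `X`, then the family is no larger
than `X`. -/
theorem IsLinear.card_le_of_forall_pair {𝒬 : Finset (Finset α)} (h : IsLinear 𝒬)
    (X : Finset (α × α))
    (hX : ∀ Q ∈ 𝒬, ∃ x ∈ Q, ∃ y ∈ Q, x ≠ y ∧ (x, y) ∈ X) : #𝒬 ≤ #X := by
  obtain rfl | ⟨Q₀, hQ₀⟩ := 𝒬.eq_empty_or_nonempty
  · simp
  have : Nonempty α := ⟨(hX Q₀ hQ₀).choose⟩
  choose! x hx y hy hxy hmem using hX
  refine card_le_card_of_injOn (fun Q => (x Q, y Q)) (fun Q hQ => hmem Q hQ) ?_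
  intro Q hQ Q' hQ' heq
  obtain ⟨h1, h2⟩ := Prod.mk.inj heq
  exact h Q hQ Q' hQ' _ _ (hxy Q hQ) (hx Q hQ) (hy Q hQ) (h1 ▸ hx Q' hQ') (h2 ▸ hy Q' hQ')

open Classical in
/-- A linear `k`-uniform family of quadratic size has `k` large sets of vertices that are pairwise
uniform and dense in its clique graph. -/
theorem eventually_exists_isUniform_parts (k M : ℕ) {γ ε : ℝ} (hγ : 0 < γ) (hε : 0 < ε)
    (hεγ : ε ≤ γ / 16) :
    ∀ᶠ n : ℕ in atTop, ∀ 𝒬 : Finset (Finset (Fin n)), IsLinear 𝒬 → (∀ Q ∈ 𝒬, #Q = k) →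
      γ * (n : ℝ) ^ 2 ≤ #𝒬 → ∃ A : Fin k → Finset (Fin n), (∀ i, M ≤ #(A i)) ∧
        ∀ i j, i ≠ j → (cliqueGraph 𝒬).IsUniform ε (A i) (A j) ∧
          γ / 16 ≤ (cliqueGraph 𝒬).edgeDensity (A i) (A j) := by
  set l : ℕ := ⌈4 / (γ / 2)⌉₊
  set b := SzemerediRegularity.bound ε l
  filter_upwards [eventually_ge_atTop (max 1 (max l (M * b)))] with n hn 𝒬 hlin hk hcard
  have hn1 : 1 ≤ n := (le_max_left _ _).trans hn
  have hnl : l ≤ n := (le_max_left _ _).trans ((le_max_right _ _).trans hn)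
  have hnM : M * b ≤ n := (le_max_right _ _).trans ((le_max_right _ _).trans hn)
  set G := cliqueGraph 𝒬
  obtain ⟨P, hP, hPl, hPb, hPu⟩ := szemeredi_regularity G hε (l := l) (by simpa using hnl)
  have hne : (univ : Finset (Fin n)).Nonempty := ⟨⟨0, hn1⟩, mem_univ _⟩
  have hsize : ∀ U ∈ P.parts, M ≤ #U := by
    intro U hU
    refine le_trans ?_ (hP.average_le_card_part hU)
    rw [card_univ, Fintype.card_fin, Nat.le_div_iff_mul_le (card_pos.2 ⟨U, hU⟩)]
    exact (Nat.mul_le_mul_left _ hPb).trans hnM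
  -- The three kinds of bad pairs, in non-uniform pairs of parts, inside a part, or in sparse pairs,
  -- number at most `γ n² / 4` each. The choice of `l` ensures this for the second kind.
  let X₁ := (P.nonUniforms G ε).biUnion fun (U, V) ↦ U ×ˢ V
  let X₂ := P.parts.biUnion offDiag
  let X₃ := (P.sparsePairs G (γ / 16)).biUnion fun (U, V) ↦ G.interedges U V
  have h1 : (#X₁ : ℝ) < 4 * ε * n ^ 2 := by
    simpa using hP.sum_nonUniforms_lt hne hε hPu
  have h2 : (#X₂ : ℝ) ≤ γ / 2 / 2 * n ^ 2 := by
    have : 4 / (γ / 2) ≤ (#P.parts : ℝ) := (Nat.le_ceil _).trans (by exact_mod_cast hPl)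
    simpa using hP.card_biUnion_offDiag_le (by positivity : 0 < γ / 2) this
  have h3 : (#X₃ : ℝ) ≤ 4 * (γ / 16) * n ^ 2 := by
    simpa using hP.card_interedges_sparsePairs_le (G := G) (by positivity : 0 ≤ γ / 16)
  have hX : #(X₁ ∪ X₂ ∪ X₃) < #𝒬 := by
    have h4 : (#(X₁ ∪ X₂ ∪ X₃) : ℝ) ≤ #X₁ + #X₂ + #X₃ := by
      exact_mod_cast (card_union_le _ _).trans (Nat.add_le_add_right (card_union_le _ _) _)
    have hn2 : (0 : ℝ) ≤ (n : ℝ) ^ 2 := by positivity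
    have h5 : (#(X₁ ∪ X₂ ∪ X₃) : ℝ) < #𝒬 := by nlinarith
    exact_mod_cast h5
  -- By linearity a bad pair spoils at most one member, so some member is unspoilt; the parts of its
  -- `k` vertices are the required sets.
  obtain ⟨Q, hQ, hgood⟩ : ∃ Q ∈ 𝒬, ∀ x ∈ Q, ∀ y ∈ Q, x ≠ y → (x, y) ∉ X₁ ∪ X₂ ∪ X₃ := by
    by_contra! hcon
    exact hX.not_ge (hlin.card_le_of_forall_pair _ hcon)
  let f : Fin k ≃ Q := (Q.equivFinOfCardEq (hk Q hQ)).symm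
  refine ⟨fun i => P.part (f i), fun i => hsize _ (P.part_mem.2 (mem_univ _)), fun i j hij => ?_⟩
  have hne : (f i : Fin n) ≠ f j := fun h => hij (f.injective (Subtype.ext h))
  have hbad := hgood _ (f i).2 _ (f j).2 hne
  have hi : P.part (f i) ∈ P.parts := P.part_mem.2 (mem_univ _)
  have hj : P.part (f j) ∈ P.parts := P.part_mem.2 (mem_univ _)
  have mi : (f i : Fin n) ∈ P.part (f i) := P.mem_part (mem_univ _)
  have mj : (f j : Fin n) ∈ P.part (f j) := P.mem_part (mem_univ _)
  simp only [mem_union, not_or] at hbad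
  obtain ⟨⟨n1, n2⟩, n3⟩ := hbad
  have hparts : P.part (f i : Fin n) ≠ P.part (f j) := fun h =>
    n2 (mem_biUnion.2 ⟨_, hi, mem_offDiag.2 ⟨mi, h ▸ mj, hne⟩⟩)
  constructor
  · by_contra hcon
    exact n1 (mem_biUnion.2 ⟨(_, _), (P.mk_mem_nonUniforms G).2 ⟨hi, hj, hparts, hcon⟩,
      mem_product.2 ⟨mi, mj⟩⟩)
  · by_contra! hcon
    exact n3 (mem_biUnion.2 ⟨(_, _), (P.mk_mem_sparsePairs G _ _ _).2 ⟨hi, hj, hparts, hcon⟩,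
      (G.mk_mem_interedges_iff).2 ⟨mi, mj, hne, Q, hQ, (f i).2, (f j).2⟩⟩)

/-- If every member of a linear `k`-uniform family meets `T` in at most two points, then all but
boundedly many points can be added to `T`. -/
theorem IsLinear.exists_card_le_of_inter_card_le_two [DecidableEq α] {𝒬 : Finset (Finset α)}
    {k : ℕ} (h : IsLinear 𝒬) (hk : ∀ Q ∈ 𝒬, #Q = k) {T : Finset α} {m : ℕ} (hTm : #T ≤ m)
    (hT : ∀ Q ∈ 𝒬, #(Q ∩ T) ≤ 2) :
    ∃ X : Finset α, #X ≤ m + m * m * k ∧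
      ∀ x ∉ X, x ∉ T ∧ ∀ Q ∈ 𝒬, #(Q ∩ insert x T) ≤ 2 := by
  -- A point `x` can create a triple intersection only with a member already containing two points
  -- of `T`. Each pair in `T` lies in at most one such member, which excludes at most `k` points.
  let Y : α × α → Finset α := fun a => {Q ∈ 𝒬 | a.1 ∈ Q ∧ a.2 ∈ Q}.biUnion id
  have hY : ∀ a ∈ T.offDiag, #(Y a) ≤ k := by
    intro a ha
    have h1 : #{Q ∈ 𝒬 | a.1 ∈ Q ∧ a.2 ∈ Q} ≤ 1 := by
      refine card_le_one.2 fun Q hQ Q' hQ' => ?_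
      rw [mem_filter] at hQ hQ'
      exact h Q hQ.1 Q' hQ'.1 _ _ (mem_offDiag.1 ha).2.2 hQ.2.1 hQ.2.2 hQ'.2.1 hQ'.2.2
    calc #(Y a) ≤ #{Q ∈ 𝒬 | a.1 ∈ Q ∧ a.2 ∈ Q} * k :=
          card_biUnion_le_card_mul _ _ _ fun Q hQ => (hk Q (mem_filter.1 hQ).1).le
      _ ≤ 1 * k := Nat.mul_le_mul_right _ h1
      _ = k := one_mul k
  refine ⟨T ∪ T.offDiag.biUnion Y, ?_, fun x hx => ?_⟩
  · refine (card_union_le _ _).trans (Nat.add_le_add hTm ?_)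
    refine (card_biUnion_le_card_mul _ _ _ hY).trans (Nat.mul_le_mul_right _ ?_)
    rw [offDiag_card]
    exact (Nat.sub_le _ _).trans (Nat.mul_le_mul hTm hTm)
  · rw [mem_union, not_or] at hx
    refine ⟨hx.1, fun Q hQ => ?_⟩
    by_cases hxQ : x ∈ Q
    · rw [inter_insert_of_mem hxQ]
      refine (card_insert_le _ _).trans ?_
      by_contra! hcon
      obtain ⟨a, ha, b, hb, hab⟩ := one_lt_card.1 (by lia : 1 < #(Q ∩ T))
      rw [mem_inter] at ha hb
      exact hx.2 (mem_biUnion.2 ⟨(a, b), mem_offDiag.2 ⟨ha.2, hb.2, hab⟩,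
        mem_biUnion.2 ⟨Q, mem_filter.2 ⟨hQ, ha.1, hb.1⟩, hxQ⟩⟩)
    · rw [inter_insert_of_notMem hxQ]
      exact hT Q hQ

/-- A linear `k`-uniform family of quadratic size contains a Berge copy of every `k`-colourable
graph. -/
theorem IsLinear.eventually_exists_berge {V : Type*} [Fintype V] {F : SimpleGraph V} {k : ℕ}
    (hF : F.Colorable k) {γ : ℝ} (hγ : 0 < γ) (hγ1 : γ ≤ 1) :
    ∀ᶠ n : ℕ in atTop, ∀ 𝒬 : Finset (Finset (Fin n)), IsLinear 𝒬 → (∀ Q ∈ 𝒬, #Q = k) →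
      γ * (n : ℝ) ^ 2 ≤ #𝒬 →
      ∃ (φ : V ↪ Fin n) (g : F.edgeSet → Finset (Fin n)), Function.Injective g ∧
        ∀ e, g e ∈ 𝒬 ∧ ∀ v ∈ (e : Sym2 V), φ v ∈ g e := by
  classical
  obtain ⟨c⟩ := hF
  set m := Fintype.card V
  set δ := γ / 16
  have hδ : 0 < δ := by positivity
  obtain ⟨ε, hε, hεδ, hpow⟩ : ∃ ε : ℝ, 0 < ε ∧ ε ≤ δ / 2 ∧ (m + 1) * ε ≤ (δ - ε) ^ m := by
    -- The first bound gives `δ - ε ≥ δ / 2`, so the second suffices for the power inequality.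
    refine ⟨min (δ / 2) ((δ / 2) ^ m / (m + 1)), by positivity, min_le_left _ _, ?_⟩
    set ε := min (δ / 2) ((δ / 2) ^ m / (m + 1))
    have h1 : ε ≤ δ / 2 := min_le_left _ _
    have h2 : ε ≤ (δ / 2) ^ m / (m + 1) := min_le_right _ _
    calc (m + 1) * ε ≤ (m + 1) * ((δ / 2) ^ m / (m + 1)) := by gcongr
      _ = (δ / 2) ^ m := by field_simp
      _ ≤ (δ - ε) ^ m := by gcongr; linarith
  set M := m + m * m * k
  filter_upwards [eventually_exists_isUniform_parts k (⌊M / ε⌋₊ + 1) hγ hε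
    (by change ε ≤ δ; linarith)] with n hn 𝒬 hlin hk hcard
  obtain ⟨A, hAM, hA⟩ := hn 𝒬 hlin hk hcard
  obtain ⟨φ, hadj, hφ⟩ := exists_embedding_of_isUniform c A hε (by linarith)
    (by change γ / 16 ≤ 1; linarith) hpow hA (M := M)
    (fun i => by
      rw [← div_lt_iff₀ hε]
      refine (Nat.lt_floor_add_one _).trans_le ?_
      exact_mod_cast hAM i)
    (fun T => ∀ Q ∈ 𝒬, #(Q ∩ T) ≤ 2) (by simp)
    (fun T hT hTm => hlin.exists_card_le_of_inter_card_le_two hk hTm.le hT)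
  have hcover : ∀ e : F.edgeSet, ∃ Q ∈ 𝒬, ∀ v ∈ (e : Sym2 V), φ v ∈ Q := by
    rintro ⟨e, he⟩
    induction e with | h u v =>
    obtain ⟨-, Q, hQ, hu, hv⟩ := hadj u v he
    refine ⟨Q, hQ, fun w hw => ?_⟩
    obtain rfl | rfl := Sym2.mem_iff.1 hw
    exacts [hu, hv]
  choose g hg hgφ using hcover
  refine ⟨φ, g, ?_, fun e => ⟨hg e, hgφ e⟩⟩
  rintro ⟨e, he⟩ ⟨e', he'⟩ heq
  -- Two different edges in the same member would put at least three image vertices into it.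
  have h1 := hφ _ (hg ⟨e, he⟩)
  have hsub : (e.toFinset ∪ e'.toFinset).image φ ⊆ g ⟨e, he⟩ ∩ univ.image φ := by
    intro x hx
    obtain ⟨v, hv, rfl⟩ := mem_image.1 hx
    refine mem_inter.2 ⟨?_, mem_image_of_mem _ (mem_univ _)⟩
    rw [mem_union, Sym2.mem_toFinset, Sym2.mem_toFinset] at hv
    obtain hv | hv := hv
    · exact hgφ ⟨e, he⟩ v hv
    · rw [heq]; exact hgφ ⟨e', he'⟩ v hv
  have h2 := (card_le_card hsub).trans h1
  rw [card_image_of_injective _ φ.injective] at h2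
  have hc : #e.toFinset = 2 := Sym2.card_toFinset_of_not_isDiag _ (F.not_isDiag_of_mem_edgeSet he)
  have hc' : #e'.toFinset = 2 :=
    Sym2.card_toFinset_of_not_isDiag _ (F.not_isDiag_of_mem_edgeSet he')
  have e1 := eq_of_subset_of_card_le (subset_union_left (s₁ := e.toFinset) (s₂ := e'.toFinset))
    (by lia)
  have e2 := eq_of_subset_of_card_le (subset_union_right (s₁ := e.toFinset) (s₂ := e'.toFinset))
    (by lia)
  have e3 : e.toFinset = e'.toFinset := e1.trans e2.symm
  refine Subtype.ext (Sym2.ext fun v => ?_)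
  rw [← Sym2.mem_toFinset, e3, Sym2.mem_toFinset]

end LinearFamily

/-! ### Ramsey's theorem -/

section Ramsey

/-- Ramsey's theorem for two colours, inside a finite set of vertices. -/
theorem exists_isNClique_or_compl {α : Type*} (B : SimpleGraph α) (s t : ℕ) (T : Finset α)
    (hT : 2 ^ (s + t) ≤ #T) :
    (∃ K ⊆ T, B.IsNClique s K) ∨ ∃ K ⊆ T, Bᶜ.IsNClique t K := by
  classical
  induction hm : s + t generalizing s t T with
  | zero =>
    obtain rfl : s = 0 := by lia
    exact Or.inl ⟨∅, by simp, by simp⟩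
  | succ m ih =>
    rw [hm] at hT
    obtain rfl | ⟨s, rfl⟩ : s = 0 ∨ ∃ s', s = s' + 1 := by cases s <;> simp
    · exact Or.inl ⟨∅, by simp, by simp⟩
    obtain rfl | ⟨t, rfl⟩ : t = 0 ∨ ∃ t', t = t' + 1 := by cases t <;> simp
    · exact Or.inr ⟨∅, by simp, by simp⟩
    obtain ⟨x, hx⟩ : T.Nonempty := card_pos.1 (lt_of_lt_of_le (by positivity) hT)
    have hsplit := card_filter_add_card_filter_not (s := T.erase x) (B.Adj x)
    rw [card_erase_of_mem hx] at hsplit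
    rw [pow_succ] at hT
    by_cases hN : 2 ^ m ≤ #{y ∈ T.erase x | B.Adj x y}
    · obtain ⟨K, hK, hc⟩ | ⟨K, hK, hc⟩ := ih s (t + 1) _ (by rwa [show s + (t + 1) = m by lia])
        (by lia)
      · refine Or.inl ⟨insert x K, ?_, hc.insert fun b hb => (mem_filter.1 (hK hb)).2⟩
        exact insert_subset hx (hK.trans ((filter_subset _ _).trans (erase_subset _ _)))
      · exact Or.inr ⟨K, hK.trans ((filter_subset _ _).trans (erase_subset _ _)), hc⟩
    -- Of at least `2 ^ (m + 1) - 1` other vertices, at most `2 ^ m - 1` are blue neighbours, so at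
    -- least `2 ^ m` are red.
    · obtain ⟨K, hK, hc⟩ | ⟨K, hK, hc⟩ := ih (s + 1) t {y ∈ T.erase x | ¬ B.Adj x y}
        (by rw [show s + 1 + t = m by lia]; lia) (by lia)
      · exact Or.inl ⟨K, hK.trans ((filter_subset _ _).trans (erase_subset _ _)), hc⟩
      · refine Or.inr ⟨insert x K, ?_, hc.insert fun b hb => ?_⟩
        · exact insert_subset hx (hK.trans ((filter_subset _ _).trans (erase_subset _ _)))
        · obtain ⟨h1, h2⟩ := mem_filter.1 (hK hb)
          exact (SimpleGraph.compl_adj _ _ _).2 ⟨(ne_of_mem_erase h1).symm, h2⟩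

theorem ramseySet_nonempty {V : Type*} [Finite V] (s : ℕ) (G : SimpleGraph V) :
    (ramseySet (SimpleGraph.completeGraph (Fin s)) G).Nonempty := by
  have := Fintype.ofFinite V
  refine ⟨2 ^ (s + Fintype.card V), fun B => ?_⟩
  obtain ⟨K, -, hK⟩ | ⟨K, -, hK⟩ := exists_isNClique_or_compl B s (Fintype.card V) univ (by simp)
  · exact Or.inl ((SimpleGraph.not_cliqueFree_iff_top_isContained s).1 hK.not_cliqueFree)
  · refine Or.inr (SimpleGraph.IsContained.trans ?_
      ((SimpleGraph.not_cliqueFree_iff_top_isContained _).1 hK.not_cliqueFree))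
    exact SimpleGraph.isContained_top_iff.2 ⟨(Fintype.equivFin V).toEmbedding⟩

/-- The Ramsey property inside a large enough finite set of vertices. -/
theorem exists_embedding_of_mem_ramseySet {U V α : Type*} {H : SimpleGraph U} {G : SimpleGraph V}
    {N : ℕ} (hN : N ∈ ramseySet H G) (B : SimpleGraph α) {T : Finset α} (hT : N ≤ #T) :
    (∃ f : U ↪ α, (∀ u, f u ∈ T) ∧ ∀ u v, H.Adj u v → B.Adj (f u) (f v)) ∨
      ∃ f : V ↪ α, (∀ v, f v ∈ T) ∧ ∀ u v, G.Adj u v → ¬ B.Adj (f u) (f v) := by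
  let ψ : Fin N ↪ α := (Fin.castLEEmb hT).trans
    (T.equivFin.symm.toEmbedding.trans (Function.Embedding.subtype _))
  have hψ : ∀ i, ψ i ∈ T := fun i => (T.equivFin.symm (Fin.castLEEmb hT i)).2
  obtain h | h := hN (B.comap ψ)
  · obtain ⟨f, hf⟩ := SimpleGraph.isContained_iff_exists_le_comap.1 h
    exact Or.inl ⟨f.trans ψ, fun u => hψ _, fun u v huv => hf huv⟩
  · obtain ⟨f, hf⟩ := SimpleGraph.isContained_iff_exists_le_comap.1 h
    refine Or.inr ⟨f.trans ψ, fun u => hψ _, fun u v huv => ?_⟩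
    exact ((SimpleGraph.compl_adj _ _ _).1 (hf huv)).2

end Ramsey

/-! ### From Berge-free hypergraphs to linear families -/

section Threshold

variable {V α : Type*} {F : SimpleGraph V}

theorem not_isBergeFree_of_injective {E : Set (Finset α)} (φ : V ↪ α)
    {g : F.edgeSet → Finset α} (hg : Function.Injective g) (hgE : ∀ e, g e ∈ E)
    (hφ : ∀ e : F.edgeSet, ∀ v ∈ (e : Sym2 V), φ v ∈ g e) : ¬ IsBergeFree F E := fun h =>
  h (Set.range g) (Set.range_subset_iff.2 hgE) ⟨φ, Equiv.ofInjective g hg, hφ⟩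

/-- If the vertices of `F` are placed inside a hyperedge `h` so that every edge other than `e` lies
in at least as many hyperedges as `F` has edges, then there is a Berge copy of `F`: the edge `e`
is represented by `h`. -/
theorem not_isBergeFree_of_codegree [Finite V] [DecidableEq α] {E : Finset (Finset α)}
    {h : Finset α} (hE : h ∈ E) (e : Sym2 V) (φ : V ↪ α) (hφ : ∀ v, φ v ∈ h)
    (hcodeg : ∀ u v, (F.deleteEdges {e}).Adj u v →
      Nat.card F.edgeSet ≤ #{h' ∈ E | φ u ∈ h' ∧ φ v ∈ h'}) :
    ¬ IsBergeFree F (E : Set (Finset α)) := by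
  classical
  have := Fintype.ofFinite F.edgeSet
  let t : F.edgeSet → Finset (Finset α) := fun a =>
    if (a : Sym2 V) = e then {h} else {h' ∈ E | ∀ v ∈ (a : Sym2 V), φ v ∈ h'}
  have ht : ∀ a : F.edgeSet, (a : Sym2 V) ≠ e → Fintype.card F.edgeSet ≤ #(t a) := by
    rintro ⟨a, ha⟩ hne
    induction a with | h u v =>
    have h1 := hcodeg u v ((SimpleGraph.deleteEdges_adj ..).2 ⟨ha, hne⟩)
    rw [Nat.card_eq_fintype_card] at h1
    refine h1.trans_eq ?_
    simp only [t, if_neg hne, Sym2.mem_iff, forall_eq_or_imp, forall_eq]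
  -- Hall's condition: one edge other than `e` already has as many candidates as `F` has edges;
  -- otherwise `S` contains at most `e`, whose candidate is `h`.
  obtain ⟨g, hg, hgt⟩ := (Finset.all_card_le_biUnion_card_iff_exists_injective t).1 fun S => by
    by_cases hS : ∃ a ∈ S, (a : Sym2 V) ≠ e
    · obtain ⟨a, ha, hne⟩ := hS
      exact (card_le_univ S).trans ((ht a hne).trans (card_le_card (subset_biUnion_of_mem t ha)))
    · push Not at hS
      obtain rfl | ⟨a, ha⟩ := S.eq_empty_or_nonempty
      · simp
      have h1 : #S ≤ 1 := card_le_one.2 fun x hx y hy => Subtype.ext ((hS x hx).trans (hS y hy).symm)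
      refine h1.trans (card_pos.2 ⟨h, mem_biUnion.2 ⟨a, ha, ?_⟩⟩)
      simp [t, hS a ha]
  have hgmem : ∀ a : F.edgeSet, g a ∈ E ∧ ∀ v ∈ (a : Sym2 V), φ v ∈ g a := by
    intro a
    have h1 := hgt a
    by_cases hae : (a : Sym2 V) = e
    · obtain h2 : g a = h := by simpa [t, hae] using h1
      rw [h2]
      exact ⟨hE, fun v _ => hφ v⟩
    · simpa [t, hae] using h1
  exact not_isBergeFree_of_injective φ hg (fun a => (hgmem a).1) fun a => (hgmem a).2

/-- In a Berge-`F`-free hypergraph, every hyperedge with at least `R(K_k, F \ e)` vertices contains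
`k` vertices whose pairs have small codegree. -/
theorem exists_subset_codegree_lt [Finite V] [DecidableEq α] {E : Finset (Finset α)} {e : Sym2 V}
    {k N : ℕ} (hfree : IsBergeFree F (E : Set (Finset α)))
    (hN : N ∈ ramseySet (SimpleGraph.completeGraph (Fin k)) (F.deleteEdges {e}))
    {h : Finset α} (hE : h ∈ E) (hNh : N ≤ #h) :
    ∃ K ⊆ h, #K = k ∧ ∀ x ∈ K, ∀ y ∈ K, x ≠ y →
      #{h' ∈ E | x ∈ h' ∧ y ∈ h'} < Nat.card F.edgeSet := by
  let B : SimpleGraph α :=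
    { Adj := fun x y => x ≠ y ∧ #{h' ∈ E | x ∈ h' ∧ y ∈ h'} < Nat.card F.edgeSet
      symm.symm := fun x y hxy => ⟨hxy.1.symm, by simpa only [and_comm] using hxy.2⟩
      loopless.irrefl := fun x hx => hx.1 rfl }
  obtain ⟨f, hfh, hf⟩ | ⟨f, hfh, hf⟩ := exists_embedding_of_mem_ramseySet hN B hNh
  · refine ⟨univ.map f, ?_, by simp, ?_⟩
    · intro x hx
      obtain ⟨i, -, rfl⟩ := mem_map.1 hx
      exact hfh i
    · intro x hx y hy hxy
      obtain ⟨i, -, rfl⟩ := mem_map.1 hx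
      obtain ⟨j, -, rfl⟩ := mem_map.1 hy
      exact (hf i j fun hij => hxy (congrArg f hij)).2
  · refine (not_isBergeFree_of_codegree hE e f hfh (fun u v huv => ?_) hfree).elim
    by_contra! hcon
    exact hf u v huv ⟨fun h => huv.ne (f.injective h), hcon⟩

/-- If each hyperedge `h` has a `k`-subset `K h` whose pairs have codegree less than `q`, then a
positive proportion of these subsets forms a linear family. -/
theorem exists_subset_isLinear_image [DecidableEq α] {E : Finset (Finset α)} {k q : ℕ}
    (hk : 2 ≤ k) (K : Finset α → Finset α) (hKsub : ∀ h ∈ E, K h ⊆ h) (hKcard : ∀ h ∈ E, #(K h) = k)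
    (hcodeg : ∀ h ∈ E, ∀ x ∈ K h, ∀ y ∈ K h, x ≠ y → #{h' ∈ E | x ∈ h' ∧ y ∈ h'} < q) :
    ∃ E' ⊆ E, Set.InjOn K E' ∧ IsLinear (E'.image K) ∧ #E ≤ #E' * (k * k * q) := by
  classical
  let p : Finset (Finset α) → Prop := fun E' => ∀ h ∈ E', ∀ h' ∈ E', ∀ x y, x ≠ y →
    x ∈ K h → y ∈ K h → x ∈ K h' → y ∈ K h' → h = h'
  obtain ⟨E', hE', hmax⟩ := exists_max_image {E' ∈ E.powerset | p E'} card
    ⟨∅, mem_filter.2 ⟨empty_mem_powerset _, by simp [p]⟩⟩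
  rw [mem_filter, mem_powerset] at hE'
  obtain ⟨hsub, hp⟩ := hE'
  have hpair : ∀ h ∈ E, ∃ x ∈ K h, ∃ y ∈ K h, x ≠ y := fun h hh =>
    one_lt_card.1 (by rw [hKcard h hh]; lia)
  refine ⟨E', hsub, ?_, ?_, ?_⟩
  · intro h hh h' hh' heq
    obtain ⟨x, hx, y, hy, hxy⟩ := hpair h (hsub hh)
    exact hp h hh h' hh' x y hxy hx hy (heq ▸ hx) (heq ▸ hy)
  · intro Q hQ Q' hQ' x y hxy hx hy hx' hy'
    obtain ⟨h, hh, rfl⟩ := mem_image.1 hQ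
    obtain ⟨h', hh', rfl⟩ := mem_image.1 hQ'
    exact congrArg K (hp h hh h' hh' x y hxy hx hy hx' hy')
  -- By maximality every `K h` shares a pair with a selected `K h'`. That pair has codegree below
  -- `q`, so each selected `h'` accounts for at most `k * k * q` hyperedges.
  · have hmeet : ∀ h ∈ E, ∃ h' ∈ E', ∃ x y, x ≠ y ∧ x ∈ K h' ∧ y ∈ K h' ∧ x ∈ K h ∧ y ∈ K h := by
      intro h hh
      by_cases hhE' : h ∈ E'
      · obtain ⟨x, hx, y, hy, hxy⟩ := hpair h hh
        exact ⟨h, hhE', x, y, hxy, hx, hy, hx, hy⟩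
      by_contra! hcon
      have hins : p (insert h E') := by
        intro a ha b hb x y hxy hxa hya hxb hyb
        obtain rfl | haE := mem_insert.1 ha
        · obtain rfl | hbE := mem_insert.1 hb
          · rfl
          · exact (hcon b hbE x y hxy hxb hyb hxa hya).elim
        · obtain rfl | hbE := mem_insert.1 hb
          · exact (hcon a haE x y hxy hxa hya hxb hyb).elim
          · exact hp a haE b hbE x y hxy hxa hya hxb hyb
      have h1 := hmax (insert h E')
        (mem_filter.2 ⟨mem_powerset.2 (insert_subset hh hsub), hins⟩)
      rw [card_insert_of_notMem hhE'] at h1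
      lia
    have hcover : E ⊆ E'.biUnion fun h' => (K h').offDiag.biUnion fun a =>
        {h ∈ E | a.1 ∈ h ∧ a.2 ∈ h} := by
      intro h hh
      obtain ⟨h', hh', x, y, hxy, hx', hy', hx, hy⟩ := hmeet h hh
      exact mem_biUnion.2 ⟨h', hh', mem_biUnion.2 ⟨(x, y), mem_offDiag.2 ⟨hx', hy', hxy⟩,
        mem_filter.2 ⟨hh, hKsub h hh hx, hKsub h hh hy⟩⟩⟩
    refine (card_le_card hcover).trans (card_biUnion_le_card_mul _ _ _ fun h' hh' => ?_)
    refine (card_biUnion_le_card_mul _ _ q fun a ha => ?_).trans (Nat.mul_le_mul_right _ ?_)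
    · obtain ⟨h1, h2, h3⟩ := mem_offDiag.1 ha
      exact (hcodeg h' (hsub hh') _ h1 _ h2 h3).le
    · rw [offDiag_card, hKcard h' (hsub hh')]
      exact Nat.sub_le _ _

/-- If `F` is `k`-colourable, then `ex_r(n, Berge-F) = o(n²)` for every `r ≥ R(K_k, F \ e)`. -/
theorem bergeEx_isLittleO [Finite V] {e : Sym2 V} {k N r : ℕ} (hk : 2 ≤ k) (hF : F.Colorable k)
    (hN : N ∈ ramseySet (SimpleGraph.completeGraph (Fin k)) (F.deleteEdges {e})) (hr : N ≤ r) :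
    (fun n : ℕ => (bergeEx F r n : ℝ)) =o[atTop] (fun n : ℕ => (n : ℝ) ^ 2) := by
  classical
  have := Fintype.ofFinite V
  rw [isLittleO_iff]
  intro c hc
  set q := Nat.card F.edgeSet
  set D := k * k * q
  set γ : ℝ := min 1 (c / (D + 1))
  have hγ : 0 < γ := by positivity
  filter_upwards [IsLinear.eventually_exists_berge hF hγ (min_le_left _ _)] with n hn
  rw [Real.norm_natCast, Real.norm_of_nonneg (by positivity)]
  refine (Nat.le_floor_iff (by positivity)).1 (Finset.sup_le fun E hE => Nat.le_floor ?_)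
  obtain ⟨-, hsized, hfree⟩ := mem_filter.1 hE
  by_contra! hcon
  have hthin := fun h (hh : h ∈ E) =>
    exists_subset_codegree_lt hfree hN hh (hr.trans_eq (hsized hh).symm)
  choose! K hKsub hKcard hK using hthin
  obtain ⟨E', hsub, hinj, hlin, hcard⟩ := exists_subset_isLinear_image hk K hKsub hKcard hK
  have hlarge : γ * (n : ℝ) ^ 2 ≤ #(E'.image K) := by
    rw [card_image_of_injOn hinj]
    have h1 : (#E : ℝ) ≤ #E' * D := by exact_mod_cast hcard
    have h2 : (0 : ℝ) ≤ #E' := Nat.cast_nonneg _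
    calc γ * (n : ℝ) ^ 2 ≤ c / (D + 1) * (n : ℝ) ^ 2 := by gcongr; exact min_le_right _ _
      _ = c * (n : ℝ) ^ 2 / (D + 1) := by ring
      _ ≤ #E' := by
        rw [div_le_iff₀ (by positivity)]
        linarith
  obtain ⟨φ, g, hg, hgQ⟩ := hn _ hlin
    (fun Q hQ => by obtain ⟨h, hh, rfl⟩ := mem_image.1 hQ; exact hKcard h (hsub hh)) hlarge
  choose hyp hhyp hKhyp using fun a => mem_image.1 (hgQ a).1
  refine not_isBergeFree_of_injective φ (g := hyp) ?_ (fun a => hsub (hhyp a))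
    (fun a v hv => hKsub _ (hsub (hhyp a)) (hKhyp a ▸ (hgQ a).2 v hv)) hfree
  intro a b hab
  apply hg
  rw [← hKhyp a, ← hKhyp b, hab]

end Threshold

end BergeThreshold

/-- For every finite graph `F` and every edge `e` of `F`, `th(F) ≤ R(K_{χ(F)}, F \ e)`. The first two
conjuncts say that the two minima in this inequality are attained, so that neither side is the
default value of `sInf`. -/
theorem theorem1p3 {V : Type*} [Finite V] (F : SimpleGraph V) (e : Sym2 V) (he : e ∈ F.edgeSet) :
    (BergeThreshold.thresholdSet F).Nonempty ∧
      (BergeThreshold.ramseySet (BergeThreshold.chromaticClique F) (F.deleteEdges {e})).Nonempty ∧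
      BergeThreshold.th F ≤
        BergeThreshold.ramsey (BergeThreshold.chromaticClique F) (F.deleteEdges {e}) := by
  have := Fintype.ofFinite V
  obtain ⟨u, v, huv⟩ : ∃ u v, F.Adj u v := by
    induction e with | h u v => exact ⟨u, v, he⟩
  have hF : F.Colorable F.chromaticNumber.toNat :=
    SimpleGraph.colorable_chromaticNumber F.colorable_of_fintype
  have hne : F.chromaticNumber ≠ ⊤ :=
    SimpleGraph.chromaticNumber_ne_top_iff_exists.2 ⟨_, F.colorable_of_fintype⟩
  have hk : 2 ≤ F.chromaticNumber.toNat := by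
    have h1 := SimpleGraph.two_le_chromaticNumber_of_adj huv
    rw [← ENat.natCast_toNat hne] at h1
    exact_mod_cast h1
  have hram := BergeThreshold.ramseySet_nonempty F.chromaticNumber.toNat (F.deleteEdges {e})
  have hN : BergeThreshold.ramsey (BergeThreshold.chromaticClique F) (F.deleteEdges {e}) ∈
      BergeThreshold.ramseySet (BergeThreshold.chromaticClique F) (F.deleteEdges {e}) :=
    Nat.sInf_mem hram
  have hmem : BergeThreshold.ramsey (BergeThreshold.chromaticClique F) (F.deleteEdges {e}) ∈
      BergeThreshold.thresholdSet F := by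
    refine ⟨?_, fun r hr => BergeThreshold.bergeEx_isLittleO hk hF hN hr⟩
    -- The threshold must be at least 2: for any colouring, one of two graphs with at least two
    -- vertices embeds.
    obtain ⟨⟨f⟩⟩ | ⟨⟨f⟩⟩ := hN ⊥
    · have h1 := Fintype.card_le_of_injective f f.injective
      rw [Fintype.card_fin, Fintype.card_fin] at h1
      exact hk.trans h1
    · have h1 := Fintype.card_le_of_injective f f.injective
      rw [Fintype.card_fin] at h1
      exact (Fintype.one_lt_card_iff.2 ⟨u, v, huv.ne⟩).trans_le h1
  exact ⟨⟨_, hmem⟩, hram, Nat.sInf_le hmem⟩
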